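/- Let $n\in\mathbb N_0$ and let $d_l,d_s,k_l,k_s,\gamma,T_i,T_\infty>0$. Put $\omega=\sqrt{d_l/d_s}$, $i^0\mathrm{erfc}=\mathrm{erfc}$, $i^{m+1}\mathrm{erfc}(x)=\int_x^{\infty}i^{m}\mathrm{erfc}(u)\,du$, and $$E_n(z)=\tfrac12\left[i^n\mathrm{erfc}(z)+i^n\mathrm{erfc}(-z)\right],\qquad F_n(z)=\tfrac12\left[i^n\mathrm{erfc}(-z)-i^n\mathrm{erfc}(z)\right].$$ Consider the two-phase Stefan problem of finding $s$, $\Psi_l$, $\Psi_s$ such that \begin{align*} &(1)\ \ \Psi_{l,t}=d_l\Psi_{l,xx},\ \ 0<x<s(t),\ t>0; \qquad (2)\ \ \Psi_{s,t}=d_s\Psi_{s,xx},\ \ x>s(t),\ t>0;\qquad (3)\ \ s(0)=0;\\ &(4)\ \ \Psi_l(s(t),t)=\Psi_s(s(t),t)=0,\ \ t>0; \qquad (5)\ \ k_s\Psi_{s,x}(s(t),t)-k_l\Psi_{l,x}(s(t),t)=\gamma s(t)^n\dot s(t),\ \ t>0;\\ &(6)\ \ k_l\Psi_{l,x}(0,t)=h_0t^{-1/2}\left[\Psi_l(0,t)-T_\infty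 t^{n/2}\right],\ \ t>0;\qquad (7)\ \ \Psi_s(x,0)=-T_ix^n,\ \ x>0. \end{align*} Solutions are classical: $s$ is continuous on $[0,\infty)$, and positive and differentiable on $(0,\infty)$; $\Psi_l$ and $\Psi_s$ are continuous on $\{0\le x\le s(t),\,t>0\}$ and $\{x\ge s(t),\,t>0\}$, and in the interiors of these sets they are $C^2$ in $x$ and differentiable in $t$; the $x$-derivatives at $x=0$ and $x=s(t)$ are one-sided; and (7) means $\Psi_s(y,t)\to -T_ix^n$ as $(y,t)\to(x,0^+)$. Suppose that $$h_0>\frac{2^n\,\Gamma\!\left(\frac n2+1\right)k_sT_i\,d_s^{(n-1)/2}}{T_\infty\sqrt\pi}.$$ Then the equation $$\frac{h_0T_\infty}{\gamma 2^n d_l^{(n+1)/2}}\;\frac{1}{e^{x^2}2^n\Gamma\!\left(\frac n2+1\right)E_n(x)+\frac{2^n\sqrt{d_l}\,h_0}{k_l}e^{x^2}\Gamma\!\left(\frac n2+\frac12\right)F_n(x)}-\frac{k_sT_id_s^{(n-1)/2}}{\gamma d_l^{(n+1)/2}}\;\frac{1}{2^ne^{x^2\omega^2}\sqrt\pi\left(E_n(x\omega)-F_n(x\omega)\right)}=x^{n+1}\qquad(\ast)$$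 has a unique solution $\nu$ in $(0,\infty)$, and, with $\eta_l=\frac{x}{2\sqrt{d_lt}}$ and $\eta_s=\frac{x}{2\sqrt{d_st}}$, a solution of (1)--(7) is given by $s(t)=2\nu\sqrt{d_lt}$ and \begin{align*} \Psi_l(x,t)&=-\frac{t^{n/2}2^nh_0T_\infty\sqrt{d_l}\,\Gamma\!\left(\frac n2+\frac12\right)\Gamma\!\left(\frac n2+1\right)\left[F_n(\eta_l)E_n(\nu)-F_n(\nu)E_n(\eta_l)\right]}{k_l\Gamma\!\left(\frac n2+1\right)E_n(\nu)+\sqrt{d_l}\,h_0\Gamma\!\left(\frac n2+\frac12\right)F_n(\nu)},\\ \Psi_s(x,t)&=t^{n/2}2^nT_id_s^{n/2}\,\Gamma(n+1)\,\frac{E_n(\eta_s)F_n(\nu\omega)-E_n(\nu\omega)F_n(\eta_s)}{E_n(\nu\omega)-F_n(\nu\omega)}. \end{align*} For $n=0$ this is Tarzia's classical solution: the condition on $h_0$ becomes $h_0>\frac{k_sT_i}{T_\infty\sqrt{\pi d_s}}$, the temperatures become $$\Psi_l(x,t)=\frac{h_0T_\infty\sqrt{\pi d_l}}{k_l}\,\frac{\mathrm{erf}(\nu)-\mathrm{erf}(\eta_l)}{1+\frac{\sqrt{\pi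 d_l}\,h_0}{k_l}\mathrm{erf}(\nu)},\qquad \Psi_s(x,t)=-T_i\left[1-\frac{\mathrm{erfc}(\eta_s)}{\mathrm{erfc}(\nu\omega)}\right],$$ and, for $x>0$, $(\ast)$ is equivalent to $$-\frac{k_sT_i}{\gamma\sqrt{\pi d_ld_s}}\,\frac{e^{-x^2\omega^2}}{\mathrm{erfc}(x\omega)}+\frac{h_0T_\infty}{\gamma\sqrt{d_l}}\,\frac{e^{-x^2}}{1+\frac{\sqrt{\pi d_l}\,h_0\,\mathrm{erf}(x)}{k_l}}=x .$$ -/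

import Mathlib

open Set Filter Topology MeasureTheory

noncomputable section

/-- The error function `erf x = (2 / √π) ∫₀ˣ exp (-u²) du`. -/
def erf (x : ℝ) : ℝ := 2 / √Real.pi * ∫ u in (0 : ℝ)..x, Real.exp (-u ^ 2)

/-- The complementary error function `erfc x = (2 / √π) ∫ₓ^∞ exp (-u²) du`. -/
def erfc (x : ℝ) : ℝ := 2 / √Real.pi * ∫ u in Ioi x, Real.exp (-u ^ 2)

/-- The repeated integrals of `erfc`:
`i⁰erfc = erfc` and `iⁿ⁺¹erfc x = ∫ₓ^∞ iⁿerfc u du`. -/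
def ierfc : ℕ → ℝ → ℝ
  | 0 => erfc
  | n + 1 => fun x => ∫ u in Ioi x, ierfc n u

/-- The even combination `E_n z = (iⁿerfc z + iⁿerfc (-z)) / 2`. -/
def En (n : ℕ) (z : ℝ) : ℝ := (ierfc n z + ierfc n (-z)) / 2

/-- The odd combination `F_n z = (iⁿerfc (-z) - iⁿerfc z) / 2`. -/
def Fn (n : ℕ) (z : ℝ) : ℝ := (ierfc n (-z) - ierfc n z) / 2

/-- The physical coefficients of the two-phase problem (plain real numbers, no laws). -/
structure StefanData where
  /-- diffusivity of the liquid phase -/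
  dl : ℝ
  /-- diffusivity of the solid phase -/
  ds : ℝ
  /-- conductivity of the liquid phase -/
  kl : ℝ
  /-- conductivity of the solid phase -/
  ks : ℝ
  /-- latent heat coefficient -/
  γ : ℝ
  /-- heat transfer coefficient at the fixed face -/
  h0 : ℝ
  /-- bulk temperature coefficient -/
  Tinf : ℝ
  /-- initial temperature coefficient -/
  Ti : ℝ

/-- `Ψ_t = d Ψ_xx` at the point `(x, t)`, in the classical sense. -/
def HeatEqAt (d : ℝ) (Ψ : ℝ → ℝ → ℝ) (x t : ℝ) : Prop :=
  ContDiffAt ℝ 2 (fun y => Ψ y t) x ∧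
    HasDerivAt (fun τ => Ψ x τ) (d * iteratedDeriv 2 (fun y => Ψ y t) x) t

/-- `(s, Ψl, Ψs)` is a classical solution of the two-phase Stefan problem with latent heat
`γ x ^ α` and a convective condition at `x = 0`. The liquid occupies `0 < x < s t` and the solid
`x > s t`, for `t > 0`. Derivatives in `x` on the fixed face and on the interface are one-sided,
taken from inside the phase in question, and the initial temperature is attained as a limit. -/
structure IsStefanSolution (D : StefanData) (α : ℝ) (s : ℝ → ℝ) (Ψl Ψs : ℝ → ℝ → ℝ) : Prop where
  interface_continuous : ContinuousOn s (Ici 0)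
  interface_pos : ∀ t, 0 < t → 0 < s t
  liquid_continuous :
    ContinuousOn (fun p : ℝ × ℝ => Ψl p.1 p.2) {p | 0 < p.2 ∧ 0 ≤ p.1 ∧ p.1 ≤ s p.2}
  solid_continuous :
    ContinuousOn (fun p : ℝ × ℝ => Ψs p.1 p.2) {p | 0 < p.2 ∧ s p.2 ≤ p.1}
  liquid_heat : ∀ x t, 0 < t → 0 < x → x < s t → HeatEqAt D.dl Ψl x t
  solid_heat : ∀ x t, 0 < t → s t < x → HeatEqAt D.ds Ψs x t
  interface_zero : s 0 = 0
  liquid_interface : ∀ t, 0 < t → Ψl (s t) t = 0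
  solid_interface : ∀ t, 0 < t → Ψs (s t) t = 0
  stefan : ∀ t, 0 < t → ∃ gs gl v : ℝ,
    HasDerivWithinAt (fun x => Ψs x t) gs (Ici (s t)) (s t) ∧
    HasDerivWithinAt (fun x => Ψl x t) gl (Icc 0 (s t)) (s t) ∧
    HasDerivAt s v t ∧
    D.ks * gs - D.kl * gl = D.γ * s t ^ α * v
  convective : ∀ t, 0 < t → ∃ g : ℝ,
    HasDerivWithinAt (fun x => Ψl x t) g (Icc 0 (s t)) 0 ∧
    D.kl * g = D.h0 * t ^ (-(1 / 2) : ℝ) * (Ψl 0 t - D.Tinf * t ^ (α / 2))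
  initial : ∀ x, 0 < x →
    Tendsto (fun p : ℝ × ℝ => Ψs p.1 p.2) (𝓝 x ×ˢ 𝓝[>] 0) (𝓝 (-D.Ti * x ^ α))

namespace StefanData

/-- `ω = √(d_l / d_s)` -/
def ω (D : StefanData) : ℝ := √(D.dl / D.ds)

/-- The lower bound required of `h0` when the exponent is `n`. -/
def threshold (D : StefanData) (n : ℕ) : ℝ :=
  2 ^ n * Real.Gamma ((n : ℝ) / 2 + 1) * D.ks * D.Ti * D.ds ^ (((n : ℝ) - 1) / 2) /
    (D.Tinf * √Real.pi)

/-- The free boundary `s t = 2 ν √(d_l t)`. -/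
def front (D : StefanData) (ν t : ℝ) : ℝ := 2 * ν * √(D.dl * t)

/-- The similarity variable `x / (2 √(d t))`. -/
def simVar (d x t : ℝ) : ℝ := x / (2 * √(d * t))

/-- The liquid temperature, with `η_l = x / (2 √(d_l t))`. -/
def liquidTemp (D : StefanData) (n : ℕ) (ν x t : ℝ) : ℝ :=
  -(t ^ ((n : ℝ) / 2) * 2 ^ n * D.h0 * D.Tinf * √D.dl * Real.Gamma ((n : ℝ) / 2 + 1 / 2) *
      Real.Gamma ((n : ℝ) / 2 + 1) *
      (Fn n (simVar D.dl x t) * En n ν - Fn n ν * En n (simVar D.dl x t))) /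
    (D.kl * Real.Gamma ((n : ℝ) / 2 + 1) * En n ν +
      √D.dl * D.h0 * Real.Gamma ((n : ℝ) / 2 + 1 / 2) * Fn n ν)

/-- The solid temperature, with `η_s = x / (2 √(d_s t))`. -/
def solidTemp (D : StefanData) (n : ℕ) (ν x t : ℝ) : ℝ :=
  t ^ ((n : ℝ) / 2) * 2 ^ n * D.Ti * D.ds ^ ((n : ℝ) / 2) * Real.Gamma ((n : ℝ) + 1) *
    ((En n (simVar D.ds x t) * Fn n (ν * D.ω) - En n (ν * D.ω) * Fn n (simVar D.ds x t)) /
      (En n (ν * D.ω) - Fn n (ν * D.ω)))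

/-- The equation that determines `ν`. -/
def NuEquation (D : StefanData) (n : ℕ) (x : ℝ) : Prop :=
  D.h0 * D.Tinf / (D.γ * 2 ^ n * D.dl ^ (((n : ℝ) + 1) / 2)) *
      (1 / (Real.exp (x ^ 2) * 2 ^ n * Real.Gamma ((n : ℝ) / 2 + 1) * En n x +
        2 ^ n * √D.dl * D.h0 / D.kl * Real.exp (x ^ 2) * Real.Gamma ((n : ℝ) / 2 + 1 / 2) *
          Fn n x)) -
    D.ks * D.Ti * D.ds ^ (((n : ℝ) - 1) / 2) / (D.γ * D.dl ^ (((n : ℝ) + 1) / 2)) *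
      (1 / (2 ^ n * Real.exp (x ^ 2 * D.ω ^ 2) * √Real.pi *
        (En n (x * D.ω) - Fn n (x * D.ω)))) =
    x ^ (n + 1)

/-- The liquid temperature of the classical solution (constant latent heat). -/
def classicalLiquidTemp (D : StefanData) (ν x t : ℝ) : ℝ :=
  D.h0 * D.Tinf * √(Real.pi * D.dl) / D.kl * (erf ν - erf (simVar D.dl x t)) /
    (1 + √(Real.pi * D.dl) * D.h0 / D.kl * erf ν)

/-- The solid temperature of the classical solution (constant latent heat). -/
def classicalSolidTemp (D : StefanData) (ν x t : ℝ) : ℝ :=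
  -D.Ti * (1 - erfc (simVar D.ds x t) / erfc (ν * D.ω))

/-- The equation for `ν` in the classical solution (constant latent heat). -/
def ClassicalNuEquation (D : StefanData) (x : ℝ) : Prop :=
  -(D.ks * D.Ti / (D.γ * √(Real.pi * D.dl * D.ds))) *
      (Real.exp (-(x ^ 2 * D.ω ^ 2)) / erfc (x * D.ω)) +
    D.h0 * D.Tinf / (D.γ * √D.dl) *
      (Real.exp (-x ^ 2) / (1 + √(Real.pi * D.dl) * D.h0 * erf x / D.kl)) =
    x

end StefanData

end

/-!
The repeated integrals `f = iⁿerfc` satisfy `f'' + 2 z f' = 2 n f`, which is the condition for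
`t ^ (n / 2) f (x / (2 √(d t)))` to solve the heat equation `Ψ_t = d Ψ_xx`
(`StefanData.heatEqAt_similarity`). The same holds for the even and odd combinations `En n` and
`Fn n`. The equation comes from the recurrence
`2 (n + 1) iⁿ⁺¹erfc z = iⁿ⁻¹erfc z - 2 z iⁿerfc z` (`shiftedErfc_recurrence`), whose two sides have
the same derivative and both vanish at infinity.

Each phase has a similarity solution whose profile `phaseProfile` vanishes at the value of the
similarity variable on the front. The initial condition follows from `En n z ∼ Fn n z ∼ zⁿ / n!`,
and the convective condition from the values of `iⁿerfc` at `0`. The Stefan condition involves the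
slopes of the profiles at the front, which the Wronskian of `En n` and `Fn n` makes explicit
(`wronskian_En_Fn`); it becomes the equation for `ν`, read as a balance between `interfaceFlux` and
a multiple of `x ^ (n + 1)` (`StefanData.stefan_balance`, `StefanData.nuEquation_iff`).

The balance has exactly one positive root. The flux is nonincreasing, because `En n` and `Fn n`
increase on `[0, ∞)` and `exp (x²) iⁿerfc x` decreases (by the recurrence its derivative is
`-2 (n + 1) exp (x²) iⁿ⁺¹erfc x`), and it is positive at `0` exactly when `h0` exceeds the
threshold, whereas the power increases strictly from `0` to `∞`. For `n = 0` one has `En 0 = 1` and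
`Fn 0 = erf`, and the formulas reduce to the classical ones.
-/


/-! ### Repeated integrals of the complementary error function -/

/-- The tail integral of a continuous function with an exponential bound: it is differentiable,
positive, and obeys the same bound as the integrand. -/
theorem tail_integral_of_le_exp {f : ℝ → ℝ} {C : ℝ} (hf : Continuous f) (hpos : ∀ x, 0 < f x)
    (hle : ∀ x, f x ≤ C * Real.exp (-x)) (x : ℝ) :
    HasDerivAt (fun y => ∫ u in Ioi y, f u) (-f x) x ∧
      0 < ∫ u in Ioi x, f u ∧ ∫ u in Ioi x, f u ≤ C * Real.exp (-x) := by
  have hexp (y : ℝ) : IntegrableOn (fun u => C * Real.exp (-u)) (Ioi y) :=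
    (integrableOn_exp_neg_Ioi y).const_mul C
  have hint (y : ℝ) : IntegrableOn f (Ioi y) :=
    (hexp y).mono' hf.aestronglyMeasurable <| ae_of_all _ fun u => by
      rw [Real.norm_of_nonneg (hpos u).le]
      exact hle u
  refine ⟨?_, ?_, ?_⟩
  · have hsplit : (fun y => ∫ u in Ioi y, f u) =
        fun y => (∫ u in Ioi (0 : ℝ), f u) - ∫ u in (0 : ℝ)..y, f u := by
      funext y
      rw [← intervalIntegral.integral_interval_add_Ioi (hint 0) (hint y)]
      ring
    rw [hsplit]
    exact (hf.integral_hasStrictDerivAt 0 x).hasDerivAt.const_sub _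
  · rw [setIntegral_pos_iff_support_of_nonneg_ae (ae_of_all _ fun u => (hpos u).le) (hint x)]
    have : Function.support f = univ := by
      ext u
      simpa using (hpos u).ne'
    simp [this]
  · calc ∫ u in Ioi x, f u ≤ ∫ u in Ioi x, C * Real.exp (-u) :=
          setIntegral_mono (hint x) (hexp x) hle
      _ = C * Real.exp (-x) := by rw [integral_const_mul, integral_exp_neg_Ioi]

noncomputable section

/-- The repeated integrals of `erfc` with the index shifted by one, so that the sequence starts with
the Gaussian `-erfc' = (2 / √π) exp (-x²)`; thus `shiftedErfc (n + 1) = iⁿerfc`. -/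
def shiftedErfc : ℕ → ℝ → ℝ
  | 0 => fun x => 2 / √Real.pi * Real.exp (-x ^ 2)
  | n + 1 => ierfc n

end

theorem shiftedErfc_succ (n : ℕ) (x : ℝ) :
    shiftedErfc (n + 1) x = ∫ u in Ioi x, shiftedErfc n u := by
  cases n with
  | zero => simp only [shiftedErfc, ierfc, erfc, integral_const_mul]
  | succ n => rfl

/-- One constant serves every `n`, since integrating `C * exp (-u)` over `(x, ∞)` reproduces the
bound. -/
theorem exists_shiftedErfc_bound : ∃ C : ℝ, ∀ n, Continuous (shiftedErfc n) ∧
    ∀ x, 0 < shiftedErfc n x ∧ shiftedErfc n x ≤ C * Real.exp (-x) := by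
  refine ⟨2 / √Real.pi * Real.exp (1 / 4), fun n => ?_⟩
  induction n with
  | zero =>
    refine ⟨by unfold shiftedErfc; fun_prop, fun x => ⟨?_, ?_⟩⟩
    · have := Real.pi_pos
      simp only [shiftedErfc]
      positivity
    · simp only [shiftedErfc]
      rw [mul_assoc, ← Real.exp_add]
      gcongr
      -- `-x² ≤ 1 / 4 - x` completes a square; it is the source of the constant.
      nlinarith [sq_nonneg (x - 1 / 2)]
  | succ n ih =>
    have key := tail_integral_of_le_exp ih.1 (fun x => (ih.2 x).1) (fun x => (ih.2 x).2)
    have hfun : shiftedErfc (n + 1) = fun x => ∫ u in Ioi x, shiftedErfc n u :=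
      funext (shiftedErfc_succ n)
    rw [hfun]
    exact ⟨continuous_iff_continuousAt.2 fun x => (key x).1.continuousAt, fun x => (key x).2⟩

theorem shiftedErfc_pos (n : ℕ) (x : ℝ) : 0 < shiftedErfc n x := by
  obtain ⟨C, hC⟩ := exists_shiftedErfc_bound
  exact ((hC n).2 x).1

theorem hasDerivAt_shiftedErfc_succ (n : ℕ) (x : ℝ) :
    HasDerivAt (shiftedErfc (n + 1)) (-shiftedErfc n x) x := by
  obtain ⟨C, hC⟩ := exists_shiftedErfc_bound
  rw [funext (shiftedErfc_succ n)]
  exact (tail_integral_of_le_exp (hC n).1 (fun x => ((hC n).2 x).1) (fun x => ((hC n).2 x).2) x).1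

theorem hasDerivAt_shiftedErfc_zero (x : ℝ) :
    HasDerivAt (shiftedErfc 0) (-(2 * x * shiftedErfc 0 x)) x := by
  have h := (((hasDerivAt_id x).pow 2).neg.exp).const_mul (2 / √Real.pi)
  refine h.congr_deriv ?_
  simp [shiftedErfc]
  ring

theorem tendsto_shiftedErfc_atTop (n : ℕ) : Tendsto (shiftedErfc n) atTop (𝓝 0) := by
  obtain ⟨C, hC⟩ := exists_shiftedErfc_bound
  have h : Tendsto (fun x : ℝ => C * Real.exp (-x)) atTop (𝓝 (C * 0)) :=
    (Real.tendsto_exp_neg_atTop_nhds_zero).const_mul C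
  rw [mul_zero] at h
  exact squeeze_zero (fun x => (shiftedErfc_pos n x).le) (fun x => ((hC n).2 x).2) h

theorem tendsto_mul_shiftedErfc_atTop (n : ℕ) :
    Tendsto (fun x => x * shiftedErfc n x) atTop (𝓝 0) := by
  obtain ⟨C, hC⟩ := exists_shiftedErfc_bound
  have h : Tendsto (fun x : ℝ => C * (x ^ 1 * Real.exp (-x))) atTop (𝓝 (C * 0)) :=
    (Real.tendsto_pow_mul_exp_neg_atTop_nhds_zero 1).const_mul C
  rw [mul_zero] at h
  refine squeeze_zero' ?_ ?_ h
  · filter_upwards [eventually_ge_atTop 0] with x hx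
    exact mul_nonneg hx (shiftedErfc_pos n x).le
  · filter_upwards [eventually_ge_atTop 0] with x hx
    nlinarith [mul_le_mul_of_nonneg_left ((hC n).2 x).2 hx]

/-- The three-term recurrence `2 (n + 1) iⁿ⁺¹erfc x = iⁿ⁻¹erfc x - 2 x iⁿerfc x`. By induction on
`n` the two sides have the same derivative, and both vanish at infinity. -/
theorem shiftedErfc_recurrence (n : ℕ) (x : ℝ) :
    2 * (n + 1) * shiftedErfc (n + 2) x = shiftedErfc n x - 2 * x * shiftedErfc (n + 1) x := by
  have main (n : ℕ)
      (hd : ∀ x, HasDerivAt (shiftedErfc n)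
        (-(2 * n * shiftedErfc (n + 1) x) - 2 * x * shiftedErfc n x) x) (x : ℝ) :
      2 * (n + 1) * shiftedErfc (n + 2) x - shiftedErfc n x + 2 * (x * shiftedErfc (n + 1) x) =
        0 := by
    set g : ℝ → ℝ := fun x =>
      2 * (n + 1) * shiftedErfc (n + 2) x - shiftedErfc n x + 2 * (x * shiftedErfc (n + 1) x)
    have hg (x : ℝ) : HasDerivAt g 0 x := by
      have h1 := (hasDerivAt_shiftedErfc_succ (n + 1) x).const_mul (2 * ((n : ℝ) + 1))
      have h2 := (((hasDerivAt_id x).mul (hasDerivAt_shiftedErfc_succ n x))).const_mul 2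
      refine ((h1.sub (hd x)).add h2).congr_deriv ?_
      simp only [id]
      ring
    have hconst (y : ℝ) : g y = g x :=
      is_const_of_deriv_eq_zero (fun z => (hg z).differentiableAt) (fun z => (hg z).deriv) y x
    have hlim : Tendsto g atTop (𝓝 (2 * (n + 1) * 0 - 0 + 2 * 0)) :=
      (((tendsto_shiftedErfc_atTop (n + 2)).const_mul _).sub (tendsto_shiftedErfc_atTop n)).add
        ((tendsto_mul_shiftedErfc_atTop (n + 1)).const_mul 2)
    have hg' : g = fun _ => g x := funext hconst
    rw [hg'] at hlim
    have := tendsto_nhds_unique tendsto_const_nhds hlim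
    simpa [g] using this
  have key : ∀ n : ℕ, ∀ x, HasDerivAt (shiftedErfc n)
      (-(2 * n * shiftedErfc (n + 1) x) - 2 * x * shiftedErfc n x) x := by
    intro n
    induction n with
    | zero =>
      intro x
      refine (hasDerivAt_shiftedErfc_zero x).congr_deriv ?_
      simp
    | succ n ih =>
      intro x
      refine (hasDerivAt_shiftedErfc_succ n x).congr_deriv ?_
      push_cast
      linarith [main n ih x]
  linarith [main n (key n) x]

/-- Together with `hasDerivAt_shiftedErfc_succ` this is the equation `f'' + 2 x f' = 2 n f`
satisfied by `f = iⁿerfc`. -/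
theorem hasDerivAt_shiftedErfc (n : ℕ) (x : ℝ) :
    HasDerivAt (shiftedErfc n) (-(2 * n * shiftedErfc (n + 1) x) - 2 * x * shiftedErfc n x) x := by
  cases n with
  | zero =>
    refine (hasDerivAt_shiftedErfc_zero x).congr_deriv ?_
    simp
  | succ n =>
    refine (hasDerivAt_shiftedErfc_succ n x).congr_deriv ?_
    push_cast
    linarith [shiftedErfc_recurrence n x]

theorem continuous_shiftedErfc (n : ℕ) : Continuous (shiftedErfc n) :=
  continuous_iff_continuousAt.2 fun x => (hasDerivAt_shiftedErfc n x).continuousAt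

theorem erfc_zero : erfc 0 = 1 := by
  have h := integral_gaussian_Ioi 1
  simp only [neg_mul, one_mul, div_one] at h
  rw [erfc, h]
  have : √Real.pi ≠ 0 := by positivity
  field_simp

/-- `iⁿerfc 0 = 1 / (2ⁿ Γ(n / 2 + 1))`, in the shifted index. -/
theorem shiftedErfc_apply_zero (n : ℕ) :
    shiftedErfc n 0 = 2 / (2 ^ n * Real.Gamma (((n : ℝ) + 1) / 2)) := by
  induction n using Nat.twoStepInduction with
  | zero => simp [shiftedErfc, Real.Gamma_one_half_eq, -one_div]
  | one => simp [shiftedErfc, ierfc, erfc_zero]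
  | more n ih _ =>
    have h := shiftedErfc_recurrence n 0
    have hG : Real.Gamma ((((n + 2 : ℕ) : ℝ) + 1) / 2) =
        ((n : ℝ) + 1) / 2 * Real.Gamma (((n : ℝ) + 1) / 2) := by
      rw [← Real.Gamma_add_one (by positivity)]
      congr 1
      push_cast
      ring
    have hpos : 0 < Real.Gamma (((n : ℝ) + 1) / 2) := Real.Gamma_pos_of_pos (by positivity)
    rw [ih] at h
    rw [hG]
    field_simp at h ⊢
    rw [pow_add]
    linarith

theorem ierfc_zero_arg (n : ℕ) :
    ierfc n 0 = 1 / (2 ^ n * Real.Gamma ((n : ℝ) / 2 + 1)) := by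
  have h := shiftedErfc_apply_zero (n + 1)
  have hG : (((n + 1 : ℕ) : ℝ) + 1) / 2 = (n : ℝ) / 2 + 1 := by
    push_cast
    ring
  have hpos : 0 < Real.Gamma ((n : ℝ) / 2 + 1) := Real.Gamma_pos_of_pos (by positivity)
  rw [hG] at h
  change ierfc n 0 = _ at h
  rw [h]
  field_simp
  ring

theorem hasDerivAt_shiftedErfc_succ_neg (n : ℕ) (x : ℝ) :
    HasDerivAt (fun z => shiftedErfc (n + 1) (-z)) (shiftedErfc n (-x)) x := by
  have h := (hasDerivAt_shiftedErfc_succ n (-x)).comp x (hasDerivAt_neg x)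
  refine h.congr_deriv ?_
  ring

theorem hasDerivAt_shiftedErfc_neg (n : ℕ) (x : ℝ) :
    HasDerivAt (fun z => shiftedErfc n (-z))
      (2 * n * shiftedErfc (n + 1) (-x) - 2 * x * shiftedErfc n (-x)) x := by
  have h := (hasDerivAt_shiftedErfc n (-x)).comp x (hasDerivAt_neg x)
  refine h.congr_deriv ?_
  ring

theorem erfc_add_erfc_neg (x : ℝ) : erfc x + erfc (-x) = 2 := by
  have hd (y : ℝ) : HasDerivAt (fun z => erfc z + erfc (-z)) 0 y := by
    refine ((hasDerivAt_shiftedErfc_succ 0 y).add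
      (hasDerivAt_shiftedErfc_succ_neg 0 y)).congr_deriv ?_
    simp [shiftedErfc]
  have h := is_const_of_deriv_eq_zero (fun z => (hd z).differentiableAt) (fun z => (hd z).deriv) x 0
  simp only [neg_zero, erfc_zero] at h
  linarith

/-- `iⁿerfc (-z) ∼ 2 zⁿ / n!` as `z → ∞`. -/
theorem tendsto_ierfc_neg_div_pow (n : ℕ) :
    Tendsto (fun z => ierfc n (-z) / z ^ n) atTop (𝓝 (2 / (n.factorial : ℝ))) := by
  -- The recurrence is a two-step one, so the preceding function is carried along.
  have key : Tendsto (fun z => shiftedErfc (n + 1) (-z) / z ^ n) atTop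
        (𝓝 (2 / (n.factorial : ℝ))) ∧
      Tendsto (fun z => shiftedErfc n (-z) / z ^ (n + 1)) atTop (𝓝 0) := by
    have hinv : Tendsto (fun z : ℝ => z⁻¹) atTop (𝓝 0) := tendsto_inv_atTop_zero
    induction n with
    | zero =>
      constructor
      · have h : Tendsto (fun z => 2 - shiftedErfc 1 z) atTop (𝓝 (2 - 0)) :=
          (tendsto_shiftedErfc_atTop 1).const_sub 2
        simp only [Nat.factorial_zero, Nat.cast_one, div_one, pow_zero, sub_zero] at h ⊢
        refine h.congr fun z => ?_
        have := erfc_add_erfc_neg z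
        change 2 - erfc z = erfc (-z)
        linarith
      · have h := (tendsto_shiftedErfc_atTop 0).mul hinv
        rw [mul_zero] at h
        refine h.congr fun z => ?_
        simp [shiftedErfc, div_eq_mul_inv]
    | succ n ih =>
      constructor
      · have h := (ih.2.add (ih.1.const_mul 2)).const_mul (1 / (2 * ((n : ℝ) + 1)))
        have hlim : 1 / (2 * ((n : ℝ) + 1)) * (0 + 2 * (2 / (n.factorial : ℝ))) =
            2 / ((n + 1).factorial : ℝ) := by
          have : (n.factorial : ℝ) ≠ 0 := by positivity
          rw [Nat.factorial_succ]
          push_cast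
          field_simp
          ring
        rw [hlim] at h
        refine h.congr' ?_
        filter_upwards [eventually_gt_atTop 0] with z hz
        have hr := shiftedErfc_recurrence n (-z)
        have hn : (n : ℝ) + 1 ≠ 0 := by positivity
        field_simp
        linear_combination (-z ^ n) * hr
      · have h := ih.1.mul (hinv.pow 2)
        simp only [ne_eq, OfNat.ofNat_ne_zero, not_false_eq_true, zero_pow, mul_zero] at h
        refine h.congr' ?_
        filter_upwards [eventually_gt_atTop 0] with z hz
        field_simp
        ring
  exact key.1

theorem tendsto_ierfc_div_pow (n : ℕ) :
    Tendsto (fun z => ierfc n z / z ^ n) atTop (𝓝 0) := by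
  refine squeeze_zero' ?_ ?_ (tendsto_shiftedErfc_atTop (n + 1))
  · filter_upwards [eventually_ge_atTop 1] with z hz
    exact div_nonneg (shiftedErfc_pos (n + 1) z).le (by positivity)
  · filter_upwards [eventually_ge_atTop 1] with z hz
    exact div_le_self (shiftedErfc_pos (n + 1) z).le (one_le_pow₀ hz)

/-! ### The even and odd combinations -/

theorem En_sub_Fn (n : ℕ) (z : ℝ) : En n z - Fn n z = ierfc n z := by
  simp only [En, Fn]
  ring

theorem ierfc_pos (n : ℕ) (z : ℝ) : 0 < ierfc n z := shiftedErfc_pos (n + 1) z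

theorem En_pos (n : ℕ) (z : ℝ) : 0 < En n z :=
  half_pos (add_pos (ierfc_pos n z) (ierfc_pos n (-z)))

theorem Fn_apply_zero (n : ℕ) : Fn n 0 = 0 := by simp [Fn]

theorem En_apply_zero (n : ℕ) : En n 0 = ierfc n 0 := by simp [En]

noncomputable section

/-- The derivative of `En n`; for `n ≥ 1` it is `Fn (n - 1)`. -/
def dEn (n : ℕ) (z : ℝ) : ℝ := (shiftedErfc n (-z) - shiftedErfc n z) / 2

/-- The derivative of `Fn n`; for `n ≥ 1` it is `En (n - 1)`. -/
def dFn (n : ℕ) (z : ℝ) : ℝ := (shiftedErfc n (-z) + shiftedErfc n z) / 2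

end

theorem hasDerivAt_En (n : ℕ) (z : ℝ) : HasDerivAt (En n) (dEn n z) z :=
  (((hasDerivAt_shiftedErfc_succ n z).add (hasDerivAt_shiftedErfc_succ_neg n z)).div_const
    2).congr_deriv (by simp only [dEn]; ring)

theorem hasDerivAt_Fn (n : ℕ) (z : ℝ) : HasDerivAt (Fn n) (dFn n z) z :=
  (((hasDerivAt_shiftedErfc_succ_neg n z).sub (hasDerivAt_shiftedErfc_succ n z)).div_const
    2).congr_deriv (by simp only [dFn]; ring)

theorem hasDerivAt_dEn (n : ℕ) (z : ℝ) :
    HasDerivAt (dEn n) (2 * n * En n z - 2 * z * dEn n z) z :=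
  (((hasDerivAt_shiftedErfc_neg n z).sub (hasDerivAt_shiftedErfc n z)).div_const
    2).congr_deriv (by simp only [dEn, En, shiftedErfc]; ring)

theorem hasDerivAt_dFn (n : ℕ) (z : ℝ) :
    HasDerivAt (dFn n) (2 * n * Fn n z - 2 * z * dFn n z) z :=
  (((hasDerivAt_shiftedErfc_neg n z).add (hasDerivAt_shiftedErfc n z)).div_const
    2).congr_deriv (by simp only [dFn, Fn, shiftedErfc]; ring)

theorem dEn_apply_zero (n : ℕ) : dEn n 0 = 0 := by simp [dEn]

theorem dFn_apply_zero (n : ℕ) :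
    dFn n 0 = 2 / (2 ^ n * Real.Gamma ((n : ℝ) / 2 + 1 / 2)) := by
  simp [dFn, shiftedErfc_apply_zero, add_div]

theorem strictMono_Fn (n : ℕ) : StrictMono (Fn n) :=
  strictMono_of_deriv_pos fun z => by
    rw [(hasDerivAt_Fn n z).deriv]
    exact half_pos (add_pos (shiftedErfc_pos n (-z)) (shiftedErfc_pos n z))

theorem Fn_nonneg (n : ℕ) {z : ℝ} (hz : 0 ≤ z) : 0 ≤ Fn n z :=
  (Fn_apply_zero n).symm.trans_le ((strictMono_Fn n).monotone hz)

theorem dEn_nonneg (n : ℕ) {z : ℝ} (hz : 0 ≤ z) : 0 ≤ dEn n z := by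
  cases n with
  | zero => simp [dEn, shiftedErfc]
  | succ n => exact Fn_nonneg n hz

theorem monotoneOn_En (n : ℕ) : MonotoneOn (En n) (Ici 0) := by
  refine monotoneOn_of_deriv_nonneg (convex_Ici 0)
    (fun z _ => (hasDerivAt_En n z).continuousAt.continuousWithinAt)
    (fun z _ => (hasDerivAt_En n z).differentiableAt.differentiableWithinAt) fun z hz => ?_
  rw [interior_Ici] at hz
  rw [(hasDerivAt_En n z).deriv]
  exact dEn_nonneg n (le_of_lt hz)

/-- The Wronskian of `En n` and `Fn n`, by Abel's identity: `exp (z²)` times it has zero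
derivative, and at `0` only the first product survives. -/
theorem wronskian_En_Fn (n : ℕ) (z : ℝ) :
    En n z * dFn n z - dEn n z * Fn n z = ierfc n 0 * dFn n 0 * Real.exp (-z ^ 2) := by
  set g : ℝ → ℝ := fun z => Real.exp (z ^ 2) * (En n z * dFn n z - dEn n z * Fn n z)
  have hg (y : ℝ) : HasDerivAt g 0 y := by
    have he : HasDerivAt (fun z : ℝ => Real.exp (z ^ 2)) (Real.exp (y ^ 2) * (2 * y)) y := by
      simpa using ((hasDerivAt_id y).pow 2).exp
    refine (he.mul (((hasDerivAt_En n y).mul (hasDerivAt_dFn n y)).sub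
      ((hasDerivAt_dEn n y).mul (hasDerivAt_Fn n y)))).congr_deriv ?_
    simp only [Pi.mul_apply, Pi.sub_apply]
    ring
  have h : g z = g 0 :=
    is_const_of_deriv_eq_zero (fun y => (hg y).differentiableAt) (fun y => (hg y).deriv) z 0
  simp only [g, Fn_apply_zero, En_apply_zero, dEn_apply_zero] at h
  rw [Real.exp_neg]
  field_simp
  simp at h
  linarith

/-- The Wronskian at `0`; the duplication formula turns the product of the two Gamma values into a
factorial. -/
theorem ierfc_zero_arg_mul_dFn (n : ℕ) :
    ierfc n 0 * dFn n 0 = 2 / (2 ^ n * √Real.pi * n.factorial) := by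
  have h := Real.Gamma_mul_Gamma_add_half ((n : ℝ) / 2 + 1 / 2)
  have h1 : (n : ℝ) / 2 + 1 / 2 + 1 / 2 = n / 2 + 1 := by ring
  have h2 : 2 * ((n : ℝ) / 2 + 1 / 2) = n + 1 := by ring
  rw [h1, h2, Real.Gamma_nat_eq_factorial, show (1 : ℝ) - (n + 1) = -n by ring,
    Real.rpow_neg (by norm_num), Real.rpow_natCast] at h
  have hG1 : 0 < Real.Gamma ((n : ℝ) / 2 + 1) := Real.Gamma_pos_of_pos (by positivity)
  have hG2 : 0 < Real.Gamma ((n : ℝ) / 2 + 1 / 2) := Real.Gamma_pos_of_pos (by positivity)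
  have hpi : 0 < √Real.pi := by positivity
  rw [ierfc_zero_arg, dFn_apply_zero]
  have hf : (0 : ℝ) < n.factorial := by positivity
  field_simp at h ⊢
  linarith

/-- `exp (x²) iⁿerfc x` is decreasing: its derivative is `-2 (n + 1) exp (x²) iⁿ⁺¹erfc x`. -/
theorem strictAnti_exp_sq_mul_ierfc (n : ℕ) :
    StrictAnti fun x => Real.exp (x ^ 2) * ierfc n x := by
  refine strictAnti_of_deriv_neg fun x => ?_
  have he : HasDerivAt (fun z : ℝ => Real.exp (z ^ 2)) (Real.exp (x ^ 2) * (2 * x)) x := by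
    simpa using ((hasDerivAt_id x).pow 2).exp
  have h := (he.mul (hasDerivAt_shiftedErfc_succ n x)).congr_deriv
    (show _ = -(2 * (n + 1) * Real.exp (x ^ 2) * shiftedErfc (n + 2) x) by
      linear_combination Real.exp (x ^ 2) * shiftedErfc_recurrence n x)
  change deriv ((fun z : ℝ => Real.exp (z ^ 2)) * shiftedErfc (n + 1)) x < 0
  rw [h.deriv]
  have := shiftedErfc_pos (n + 2) x
  rw [neg_lt_zero]
  positivity

theorem tendsto_En_div_pow (n : ℕ) :
    Tendsto (fun z => En n z / z ^ n) atTop (𝓝 (1 / (n.factorial : ℝ))) := by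
  have h := ((tendsto_ierfc_div_pow n).add (tendsto_ierfc_neg_div_pow n)).div_const 2
  refine (h.congr fun z => ?_).trans_eq ?_
  · simp only [En]
    ring
  · congr 1
    ring

theorem tendsto_Fn_div_pow (n : ℕ) :
    Tendsto (fun z => Fn n z / z ^ n) atTop (𝓝 (1 / (n.factorial : ℝ))) := by
  have h := ((tendsto_ierfc_neg_div_pow n).sub (tendsto_ierfc_div_pow n)).div_const 2
  refine (h.congr fun z => ?_).trans_eq ?_
  · simp only [Fn]
    ring
  · congr 1
    ring

/-! ### Similarity solutions of the heat equation -/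

theorem rpow_natCast_div_two {x : ℝ} (hx : 0 ≤ x) (n : ℕ) : x ^ ((n : ℝ) / 2) = √x ^ n := by
  rw [Real.rpow_div_two_eq_sqrt _ hx, Real.rpow_natCast]

namespace StefanData

theorem hasDerivAt_similarity_space {f f' : ℝ → ℝ} (hf : ∀ z, HasDerivAt f (f' z) z)
    (c d x t : ℝ) :
    HasDerivAt (fun y => c * f (simVar d y t))
      (c * f' (simVar d x t) * (1 / (2 * √(d * t)))) x := by
  have hv : HasDerivAt (fun y => simVar d y t) (1 / (2 * √(d * t))) x := by
    simpa [simVar] using (hasDerivAt_id x).div_const (2 * √(d * t))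
  refine (((hf _).comp x hv).const_mul c).congr_deriv ?_
  ring

theorem hasDerivAt_simVar_time {d t : ℝ} (hd : 0 < d) (ht : 0 < t) (x : ℝ) :
    HasDerivAt (fun τ => simVar d x τ) (-(simVar d x t / (2 * t))) t := by
  have hs : HasDerivAt (fun τ => 2 * √(d * τ)) (2 * (d * 1 / (2 * √(d * t)))) t :=
    (((hasDerivAt_id t).const_mul d).sqrt (mul_pos hd ht).ne').const_mul 2
  have hr : 0 < √(d * t) := Real.sqrt_pos.2 (mul_pos hd ht)
  refine ((hasDerivAt_const t x).div hs (by positivity)).congr_deriv ?_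
  have hsq : √(d * t) ^ 2 = d * t := Real.sq_sqrt (mul_pos hd ht).le
  simp only [simVar]
  generalize √(d * t) = r at *
  field_simp
  rw [hsq]
  ring

/-- If `f'' = 2 n f - 2 z f'`, then `t ^ (n / 2) f (x / (2 √(d t)))` solves `Ψ_t = d Ψ_xx`. -/
theorem heatEqAt_similarity {d : ℝ} (hd : 0 < d) (n : ℕ) {f f' : ℝ → ℝ}
    (hf : ∀ z, HasDerivAt f (f' z) z)
    (hf' : ∀ z, HasDerivAt f' (2 * n * f z - 2 * z * f' z) z) (x : ℝ) {t : ℝ} (ht : 0 < t) :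
    HeatEqAt d (fun x t => t ^ ((n : ℝ) / 2) * f (simVar d x t)) x t := by
  have hcf : Continuous f := continuous_iff_continuousAt.2 fun z => (hf z).continuousAt
  have hcf' : Continuous f' := continuous_iff_continuousAt.2 fun z => (hf' z).continuousAt
  have hC1 : ContDiff ℝ 1 f' := by
    rw [contDiff_one_iff_deriv]
    refine ⟨fun z => (hf' z).differentiableAt, ?_⟩
    rw [funext fun z => (hf' z).deriv]
    fun_prop
  have hC2 : ContDiff ℝ 2 f := by
    rw [show (2 : WithTop ℕ∞) = 1 + 1 by norm_num, contDiff_succ_iff_deriv]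
    refine ⟨fun z => (hf z).differentiableAt, by simp, ?_⟩
    rwa [funext fun z => (hf z).deriv]
  refine ⟨?_, ?_⟩
  · have hv : ContDiff ℝ 2 fun y => simVar d y t := contDiff_id.div_const _
    exact (contDiff_const.mul (hC2.comp hv)).contDiffAt
  · set c := t ^ ((n : ℝ) / 2) with hc
    have h1 := hasDerivAt_similarity_space hf c d (t := t)
    have h2 := hasDerivAt_similarity_space hf' (c * (1 / (2 * √(d * t)))) d x t
    have hxx : iteratedDeriv 2 (fun y => c * f (simVar d y t)) x =
        c * (1 / (2 * √(d * t))) *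
          (2 * n * f (simVar d x t) - 2 * simVar d x t * f' (simVar d x t)) *
          (1 / (2 * √(d * t))) := by
      rw [iteratedDeriv_succ, iteratedDeriv_one, funext fun y => (h1 y).deriv, ← h2.deriv]
      congr 1
      funext y
      ring
    have ht' := (Real.hasDerivAt_rpow_const (p := (n : ℝ) / 2) (Or.inl ht.ne')).mul
      ((hf _).comp t (hasDerivAt_simVar_time hd ht x))
    refine ht'.congr_deriv ?_
    have hpow : t ^ ((n : ℝ) / 2 - 1) = c / t := by
      rw [hc, Real.rpow_sub_one ht.ne']
    have hsq : √(d * t) ^ 2 = d * t := Real.sq_sqrt (mul_pos hd ht).le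
    have hr : 0 < √(d * t) := Real.sqrt_pos.2 (mul_pos hd ht)
    simp only [Function.comp_apply]
    rw [hxx, hpow, ← hc]
    generalize simVar d x t = η
    generalize √(d * t) = r at *
    field_simp
    rw [hsq]
    ring

theorem continuousOn_similarity {d : ℝ} (hd : 0 < d) (a : ℝ) {f : ℝ → ℝ} (hf : Continuous f) :
    ContinuousOn (fun p : ℝ × ℝ => p.2 ^ a * f (simVar d p.1 p.2)) {p | 0 < p.2} := by
  refine ContinuousOn.mul ?_ (hf.comp_continuousOn ?_)
  · exact continuousOn_snd.rpow_const fun p hp => Or.inl (ne_of_gt hp)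
  · refine continuousOn_fst.div ?_ fun p hp => ?_
    · exact ContinuousOn.mul continuousOn_const
        (Real.continuous_sqrt.comp_continuousOn (continuousOn_const.mul continuousOn_snd))
    · have := Real.sqrt_pos.2 (mul_pos hd hp)
      positivity

/-- The initial values of a similarity solution come from the growth of its profile. -/
theorem tendsto_similarity_initial {d : ℝ} (hd : 0 < d) (n : ℕ) {f : ℝ → ℝ} {L : ℝ}
    (hf : Tendsto (fun z => f z / z ^ n) atTop (𝓝 L)) {x : ℝ} (hx : 0 < x) :
    Tendsto (fun p : ℝ × ℝ => p.2 ^ ((n : ℝ) / 2) * f (simVar d p.1 p.2)) (𝓝 x ×ˢ 𝓝[>] 0)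
      (𝓝 ((x / (2 * √d)) ^ n * L)) := by
  have hfst : Tendsto (fun p : ℝ × ℝ => p.1) (𝓝 x ×ˢ 𝓝[>] (0 : ℝ)) (𝓝 x) := tendsto_fst
  have hsnd : Tendsto (fun p : ℝ × ℝ => p.2) (𝓝 x ×ˢ 𝓝[>] (0 : ℝ)) (𝓝[>] 0) := tendsto_snd
  have hden : Tendsto (fun t : ℝ => 2 * √(d * t)) (𝓝[>] 0) (𝓝[>] 0) := by
    refine tendsto_nhdsWithin_iff.2 ⟨?_, ?_⟩
    · have hc : Continuous fun t : ℝ => 2 * √(d * t) := by fun_prop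
      have h0 := hc.tendsto 0
      simp only [mul_zero, Real.sqrt_zero] at h0
      exact h0.mono_left nhdsWithin_le_nhds
    · filter_upwards [self_mem_nhdsWithin] with t ht
      have := Real.sqrt_pos.2 (mul_pos hd (mem_Ioi.1 ht))
      exact mem_Ioi.2 (by positivity)
  have hη : Tendsto (fun p : ℝ × ℝ => simVar d p.1 p.2) (𝓝 x ×ˢ 𝓝[>] 0) atTop :=
    hfst.pos_mul_atTop hx (tendsto_inv_nhdsGT_zero.comp (hden.comp hsnd))
  refine (((hfst.div_const (2 * √d)).pow n).mul (hf.comp hη)).congr' ?_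
  filter_upwards [hfst.eventually (lt_mem_nhds hx),
    hsnd.eventually self_mem_nhdsWithin] with p hp ht
  have ht' : 0 < p.2 := ht
  have hrt : 0 < √p.2 := Real.sqrt_pos.2 ht'
  have hrd : 0 < √d := Real.sqrt_pos.2 hd
  have hp' : 0 < p.1 := hp
  rw [rpow_natCast_div_two ht'.le, Function.comp_apply]
  generalize hz : simVar d p.1 p.2 = z
  have hz' : p.1 / (2 * √d) = √p.2 * z := by
    rw [← hz, simVar, Real.sqrt_mul hd.le]
    field_simp
  have hzpos : 0 < z := by
    have : 0 < √p.2 * z := hz' ▸ (by positivity)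
    exact pos_of_mul_pos_right this hrt.le
  rw [hz', mul_pow]
  field_simp

end StefanData

noncomputable section

/-! ### The profiles of the two temperatures -/

namespace StefanData

/-- The denominator of the liquid temperature. -/
def liquidDenom (D : StefanData) (n : ℕ) (x : ℝ) : ℝ :=
  D.kl * Real.Gamma ((n : ℝ) / 2 + 1) * En n x +
    √D.dl * D.h0 * Real.Gamma ((n : ℝ) / 2 + 1 / 2) * Fn n x

/-- The factor multiplying the combination of `En` and `Fn` in the liquid temperature. -/
def liquidCoeff (D : StefanData) (n : ℕ) (ν : ℝ) : ℝ :=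
  2 ^ n * D.h0 * D.Tinf * √D.dl * Real.Gamma ((n : ℝ) / 2 + 1 / 2) *
    Real.Gamma ((n : ℝ) / 2 + 1) / D.liquidDenom n ν

/-- The factor multiplying the combination of `En` and `Fn` in the solid temperature. -/
def solidCoeff (D : StefanData) (n : ℕ) (ν : ℝ) : ℝ :=
  2 ^ n * D.Ti * √D.ds ^ n * n.factorial / ierfc n (ν * D.ω)

end StefanData

/-- The combination of `En` and `Fn` that vanishes at `b` and has slope `-C` times their Wronskian
there. Both phases have a profile of this kind. -/
def phaseProfile (n : ℕ) (C b z : ℝ) : ℝ := C * (Fn n b * En n z - En n b * Fn n z)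

/-- The derivative of `phaseProfile`. -/
def dphaseProfile (n : ℕ) (C b z : ℝ) : ℝ := C * (Fn n b * dEn n z - En n b * dFn n z)

end

theorem phaseProfile_self (n : ℕ) (C b : ℝ) : phaseProfile n C b b = 0 := by
  simp only [phaseProfile]
  ring

theorem dphaseProfile_self (n : ℕ) (C b : ℝ) :
    dphaseProfile n C b b = -(C * (ierfc n 0 * dFn n 0 * Real.exp (-b ^ 2))) := by
  rw [← wronskian_En_Fn, dphaseProfile]
  ring

theorem hasDerivAt_phaseProfile (n : ℕ) (C b z : ℝ) :
    HasDerivAt (phaseProfile n C b) (dphaseProfile n C b z) z :=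
  (((hasDerivAt_En n z).const_mul _).sub ((hasDerivAt_Fn n z).const_mul _)).const_mul C

theorem hasDerivAt_dphaseProfile (n : ℕ) (C b z : ℝ) :
    HasDerivAt (dphaseProfile n C b)
      (2 * n * phaseProfile n C b z - 2 * z * dphaseProfile n C b z) z :=
  ((((hasDerivAt_dEn n z).const_mul _).sub ((hasDerivAt_dFn n z).const_mul _)).const_mul
    C).congr_deriv (by simp only [phaseProfile, dphaseProfile]; ring)

theorem continuous_phaseProfile (n : ℕ) (C b : ℝ) : Continuous (phaseProfile n C b) :=
  continuous_iff_continuousAt.2 fun z => (hasDerivAt_phaseProfile n C b z).continuousAt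

theorem tendsto_phaseProfile_div_pow (n : ℕ) (C b : ℝ) :
    Tendsto (fun z => phaseProfile n C b z / z ^ n) atTop
      (𝓝 (-(C * ierfc n b / n.factorial))) := by
  have h := (((tendsto_En_div_pow n).const_mul (Fn n b)).sub
    ((tendsto_Fn_div_pow n).const_mul (En n b))).const_mul C
  refine (h.congr fun z => ?_).trans_eq ?_
  · simp only [phaseProfile]
    ring
  · congr 1
    rw [← En_sub_Fn]
    ring

namespace StefanData

theorem liquidTemp_eq (D : StefanData) (n : ℕ) (ν : ℝ) :
    D.liquidTemp n ν = fun x t =>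
      t ^ ((n : ℝ) / 2) * phaseProfile n (D.liquidCoeff n ν) ν (simVar D.dl x t) := by
  funext x t
  simp only [liquidTemp, phaseProfile, liquidCoeff, liquidDenom]
  ring

theorem solidTemp_eq (D : StefanData) (hds : 0 < D.ds) (n : ℕ) (ν : ℝ) :
    D.solidTemp n ν = fun x t =>
      t ^ ((n : ℝ) / 2) * phaseProfile n (D.solidCoeff n ν) (ν * D.ω) (simVar D.ds x t) := by
  funext x t
  simp only [solidTemp, phaseProfile, solidCoeff, En_sub_Fn, Real.Gamma_nat_eq_factorial,
    rpow_natCast_div_two hds.le]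
  ring

theorem Gamma_half_pos (n : ℕ) : 0 < Real.Gamma ((n : ℝ) / 2 + 1 / 2) :=
  Real.Gamma_pos_of_pos (by positivity)

theorem Gamma_one_pos (n : ℕ) : 0 < Real.Gamma ((n : ℝ) / 2 + 1) :=
  Real.Gamma_pos_of_pos (by positivity)

theorem liquidDenom_pos (D : StefanData) (hkl : 0 < D.kl) (hh0 : 0 < D.h0) (n : ℕ) {x : ℝ}
    (hx : 0 ≤ x) : 0 < D.liquidDenom n x := by
  have h1 := mul_pos (mul_pos hkl (Gamma_one_pos n)) (En_pos n x)
  have h2 := mul_nonneg (mul_nonneg (mul_nonneg (Real.sqrt_nonneg D.dl) hh0.le)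
    (Gamma_half_pos n).le) (Fn_nonneg n hx)
  exact add_pos_of_pos_of_nonneg h1 h2

end StefanData

noncomputable section

/-! ### The equation for the front -/

namespace StefanData

/-- The heat flux from the liquid into the interface `s t = 2 x √(d_l t)`, minus the flux from the
interface into the solid, without the factor `t ^ ((n - 1) / 2)` common to both. -/
def interfaceFlux (D : StefanData) (n : ℕ) (x : ℝ) : ℝ :=
  D.h0 * D.Tinf * D.kl / (2 ^ n * (Real.exp (x ^ 2) * D.liquidDenom n x)) -
    D.ks * D.Ti * √D.ds ^ n /
      (√D.ds * √Real.pi * (Real.exp ((x * D.ω) ^ 2) * ierfc n (x * D.ω)))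

end StefanData

end

namespace StefanData

theorem rpow_add_one_div_two {x : ℝ} (hx : 0 ≤ x) (n : ℕ) :
    x ^ (((n : ℝ) + 1) / 2) = √x ^ (n + 1) := by
  rw [← rpow_natCast_div_two hx]
  norm_num

theorem rpow_sub_one_div_two {x : ℝ} (hx : 0 < x) (n : ℕ) :
    x ^ (((n : ℝ) - 1) / 2) = √x ^ n / √x := by
  rw [← rpow_natCast_div_two hx.le, sub_div, Real.rpow_sub hx, ← Real.sqrt_eq_rpow]

theorem nuEquation_iff (D : StefanData) (hdl : 0 < D.dl) (hds : 0 < D.ds) (hkl : 0 < D.kl)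
    (hγ : 0 < D.γ) (hh0 : 0 < D.h0) (n : ℕ) {x : ℝ} (hx : 0 < x) :
    D.NuEquation n x ↔ D.interfaceFlux n x = D.γ * 2 ^ n * √D.dl ^ (n + 1) * x ^ (n + 1) := by
  have hpl : 0 < √D.dl := Real.sqrt_pos.2 hdl
  have hps : 0 < √D.ds := Real.sqrt_pos.2 hds
  have hpi : 0 < √Real.pi := by positivity
  have hden := D.liquidDenom_pos hkl hh0 n hx.le
  have hc := ierfc_pos n (x * D.ω)
  have hD : Real.exp (x ^ 2) * 2 ^ n * Real.Gamma ((n : ℝ) / 2 + 1) * En n x +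
      2 ^ n * √D.dl * D.h0 / D.kl * Real.exp (x ^ 2) * Real.Gamma ((n : ℝ) / 2 + 1 / 2) * Fn n x =
      2 ^ n * (Real.exp (x ^ 2) * D.liquidDenom n x) / D.kl := by
    simp only [liquidDenom]
    field_simp
  rw [NuEquation, hD, En_sub_Fn, rpow_add_one_div_two hdl.le, rpow_sub_one_div_two hds,
    ← mul_pow, interfaceFlux]
  have hscale : D.γ * 2 ^ n * √D.dl ^ (n + 1) ≠ 0 := by positivity
  rw [← mul_right_inj' hscale]
  refine Eq.congr ?_ rfl
  have he1 := Real.exp_pos (x ^ 2)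
  have he2 := Real.exp_pos ((x * D.ω) ^ 2)
  field_simp

/-- Heating through the liquid weakens as the front recedes, because `exp (x²)`, `En` and `Fn` grow,
while cooling through the solid strengthens, because `exp (x²) iⁿerfc x` decays. -/
theorem antitoneOn_interfaceFlux (D : StefanData) (hds : 0 < D.ds) (hkl : 0 < D.kl)
    (hks : 0 < D.ks) (hTinf : 0 < D.Tinf) (hTi : 0 < D.Ti) (hh0 : 0 < D.h0) (n : ℕ) :
    AntitoneOn (D.interfaceFlux n) (Ici 0) := by
  intro x hx y hy hxy
  have hx : 0 ≤ x := hx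
  have hω : 0 ≤ D.ω := Real.sqrt_nonneg _
  have hps : 0 < √D.ds := Real.sqrt_pos.2 hds
  have hpi : 0 < √Real.pi := by positivity
  have hdx := D.liquidDenom_pos hkl hh0 n hx
  have hden : D.liquidDenom n x ≤ D.liquidDenom n y := by
    have h1 := monotoneOn_En n hx hy hxy
    have h2 := (strictMono_Fn n).monotone hxy
    have := Gamma_one_pos n
    have := Gamma_half_pos n
    simp only [liquidDenom]
    gcongr
  have hsol := (strictAnti_exp_sq_mul_ierfc n).antitone (mul_le_mul_of_nonneg_right hxy hω)
  have hcy := ierfc_pos n (y * D.ω)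
  simp only [interfaceFlux]
  gcongr

theorem continuousOn_interfaceFlux (D : StefanData) (hds : 0 < D.ds) (hkl : 0 < D.kl)
    (hh0 : 0 < D.h0) (n : ℕ) : ContinuousOn (D.interfaceFlux n) (Ici 0) := by
  have hps : 0 < √D.ds := Real.sqrt_pos.2 hds
  have hpi : 0 < √Real.pi := by positivity
  have hE : Continuous (En n) :=
    continuous_iff_continuousAt.2 fun z => (hasDerivAt_En n z).continuousAt
  have hF : Continuous (Fn n) :=
    continuous_iff_continuousAt.2 fun z => (hasDerivAt_Fn n z).continuousAt
  have hI : Continuous (ierfc n) := continuous_shiftedErfc (n + 1)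
  have hden : Continuous (D.liquidDenom n) := by
    unfold liquidDenom
    fun_prop
  unfold interfaceFlux
  refine ContinuousOn.sub ?_ ?_
  · refine continuousOn_const.div (by fun_prop) fun x hx => ?_
    have := D.liquidDenom_pos hkl hh0 n hx
    positivity
  · refine continuousOn_const.div (by fun_prop) fun x hx => ?_
    have := ierfc_pos n (x * D.ω)
    positivity

theorem threshold_pos (D : StefanData) (hds : 0 < D.ds) (hks : 0 < D.ks) (hTinf : 0 < D.Tinf)
    (hTi : 0 < D.Ti) (n : ℕ) : 0 < D.threshold n := by
  have := Gamma_one_pos n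
  have := Real.pi_pos
  have := Real.rpow_pos_of_pos hds (((n : ℝ) - 1) / 2)
  simp only [threshold]
  positivity

/-- This is where the lower bound on `h0` enters. -/
theorem interfaceFlux_zero_pos (D : StefanData) (hds : 0 < D.ds) (hkl : 0 < D.kl)
    (hTinf : 0 < D.Tinf) (n : ℕ) (hh0 : D.threshold n < D.h0) : 0 < D.interfaceFlux n 0 := by
  have hG := Gamma_one_pos n
  have hps : 0 < √D.ds := Real.sqrt_pos.2 hds
  have hpi : 0 < √Real.pi := by positivity
  simp only [threshold, rpow_sub_one_div_two hds] at hh0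
  rw [div_lt_iff₀ (by positivity)] at hh0
  simp only [interfaceFlux, liquidDenom, Fn_apply_zero, En_apply_zero, ierfc_zero_arg, zero_mul,
    mul_zero, add_zero, ne_eq, OfNat.ofNat_ne_zero, not_false_eq_true, zero_pow, Real.exp_zero,
    one_mul]
  rw [sub_pos]
  field_simp at hh0 ⊢
  linarith

theorem existsUnique_nuEquation (D : StefanData) (hdl : 0 < D.dl) (hds : 0 < D.ds)
    (hkl : 0 < D.kl) (hks : 0 < D.ks) (hγ : 0 < D.γ) (hTinf : 0 < D.Tinf) (hTi : 0 < D.Ti) (n : ℕ)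
    (hh0 : D.threshold n < D.h0) :
    ∃ ν : ℝ, 0 < ν ∧ D.NuEquation n ν ∧ ∀ x : ℝ, 0 < x → D.NuEquation n x → x = ν := by
  have hh : 0 < D.h0 := (D.threshold_pos hds hks hTinf hTi n).trans hh0
  have hpl : 0 < √D.dl := Real.sqrt_pos.2 hdl
  set c := D.γ * 2 ^ n * √D.dl ^ (n + 1)
  have hc : 0 < c := by positivity
  have hanti := D.antitoneOn_interfaceFlux hds hkl hks hTinf hTi hh n
  have h0 := D.interfaceFlux_zero_pos hds hkl hTinf n hh0
  set g : ℝ → ℝ := fun x => c * x ^ (n + 1) - D.interfaceFlux n x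
  have hmono : StrictMonoOn g (Ici 0) := by
    intro x hx y hy hxy
    have h1 := hanti hx hy hxy.le
    have h2 : x ^ (n + 1) < y ^ (n + 1) := pow_lt_pow_left₀ hxy hx n.succ_ne_zero
    have h3 := mul_lt_mul_of_pos_left h2 hc
    simp only [g]
    linarith
  have hcont : ContinuousOn g (Ici 0) :=
    (by fun_prop : Continuous fun x : ℝ => c * x ^ (n + 1)).continuousOn.sub
      (D.continuousOn_interfaceFlux hds hkl hh n)
  have hg0 : g 0 < 0 := by simpa [g] using h0
  -- Beyond `1` the power dominates its argument, so this point lies to the right of the root.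
  set m := max 1 (D.interfaceFlux n 0 / c)
  have hm1 : 1 ≤ m := le_max_left _ _
  have hgm : 0 ≤ g m := by
    have h1 := hanti (mem_Ici.2 le_rfl) (mem_Ici.2 (zero_le_one.trans hm1)) (zero_le_one.trans hm1)
    have h2 : m ≤ m ^ (n + 1) := le_self_pow₀ hm1 n.succ_ne_zero
    have h3 : D.interfaceFlux n 0 ≤ m * c := (div_le_iff₀ hc).1 (le_max_right _ _)
    have h4 := mul_le_mul_of_nonneg_left h2 hc.le
    simp only [g]
    linarith
  obtain ⟨ν, hν, hgν⟩ := intermediate_value_Icc (zero_le_one.trans hm1)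
    (hcont.mono Icc_subset_Ici_self) ⟨hg0.le, hgm⟩
  have hνpos : 0 < ν := hν.1.lt_of_ne fun h => by
    rw [← h] at hgν
    exact hg0.ne hgν
  refine ⟨ν, hνpos, (D.nuEquation_iff hdl hds hkl hγ hh n hνpos).2 (sub_eq_zero.1 hgν).symm,
    fun x hx hx' => hmono.injOn hx.le hνpos.le ?_⟩
  rw [hgν, sub_eq_zero]
  exact ((D.nuEquation_iff hdl hds hkl hγ hh n hx).1 hx').symm

/-! ### The boundary conditions -/

theorem simVar_liquid_front (D : StefanData) (hdl : 0 < D.dl) (ν : ℝ) {t : ℝ} (ht : 0 < t) :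
    simVar D.dl (D.front ν t) t = ν := by
  have := Real.sqrt_pos.2 (mul_pos hdl ht)
  simp only [simVar, front]
  field_simp

theorem simVar_solid_front (D : StefanData) (hdl : 0 < D.dl) (hds : 0 < D.ds) (ν : ℝ) {t : ℝ}
    (ht : 0 < t) : simVar D.ds (D.front ν t) t = ν * D.ω := by
  have := Real.sqrt_pos.2 ht
  have := Real.sqrt_pos.2 hds
  simp only [simVar, front, ω, Real.sqrt_mul hdl.le, Real.sqrt_mul hds.le, Real.sqrt_div hdl.le]
  field_simp

theorem hasDerivAt_front (D : StefanData) (hdl : 0 < D.dl) (ν : ℝ) {t : ℝ} (ht : 0 < t) :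
    HasDerivAt (D.front ν) (ν * √D.dl / √t) t := by
  have h := (((hasDerivAt_id t).const_mul D.dl).sqrt (mul_pos hdl ht).ne').const_mul (2 * ν)
  refine h.congr_deriv ?_
  have h1 := Real.sqrt_pos.2 ht
  have h2 := Real.sqrt_pos.2 hdl
  have h3 : √D.dl ^ 2 = D.dl := Real.sq_sqrt hdl.le
  simp only [id, Real.sqrt_mul hdl.le]
  field_simp
  rw [h3]

/-- The Stefan condition is `interfaceFlux` balanced against the latent heat. -/
theorem stefan_balance (D : StefanData) (hdl : 0 < D.dl) (hds : 0 < D.ds) (hkl : 0 < D.kl)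
    (hγ : 0 < D.γ) (hh0 : 0 < D.h0) (n : ℕ) {ν : ℝ} (hν : 0 < ν) (heq : D.NuEquation n ν)
    {t : ℝ} (ht : 0 < t) :
    D.ks * (t ^ ((n : ℝ) / 2) * dphaseProfile n (D.solidCoeff n ν) (ν * D.ω) (ν * D.ω) *
        (1 / (2 * √(D.ds * t)))) -
      D.kl * (t ^ ((n : ℝ) / 2) * dphaseProfile n (D.liquidCoeff n ν) ν ν *
        (1 / (2 * √(D.dl * t)))) =
      D.γ * D.front ν t ^ (n : ℝ) * (ν * √D.dl / √t) := by
  have hflux := (D.nuEquation_iff hdl hds hkl hγ hh0 n hν).1 heq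
  have hrt := Real.sqrt_pos.2 ht
  have hrl := Real.sqrt_pos.2 hdl
  have hrs := Real.sqrt_pos.2 hds
  have hpi : 0 < √Real.pi := by positivity
  have hden := D.liquidDenom_pos hkl hh0 n hν.le
  have hc := ierfc_pos n (ν * D.ω)
  have hG1 := Gamma_one_pos n
  have hG2 := Gamma_half_pos n
  have hfac : (0 : ℝ) < n.factorial := by positivity
  have hsolid : D.solidCoeff n ν *
      (ierfc n 0 * dFn n 0 * Real.exp (-(ν * D.ω) ^ 2)) / (2 * √D.ds) * D.ks =
      D.ks * D.Ti * √D.ds ^ n /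
        (√D.ds * √Real.pi * (Real.exp ((ν * D.ω) ^ 2) * ierfc n (ν * D.ω))) := by
    rw [ierfc_zero_arg_mul_dFn, solidCoeff, Real.exp_neg]
    have := Real.exp_pos ((ν * D.ω) ^ 2)
    field_simp
  have hliquid : D.liquidCoeff n ν *
      (ierfc n 0 * dFn n 0 * Real.exp (-ν ^ 2)) / (2 * √D.dl) * D.kl =
      D.h0 * D.Tinf * D.kl / (2 ^ n * (Real.exp (ν ^ 2) * D.liquidDenom n ν)) := by
    rw [ierfc_zero_arg, dFn_apply_zero, liquidCoeff, Real.exp_neg]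
    have := Real.exp_pos (ν ^ 2)
    field_simp
  rw [interfaceFlux, ← hliquid, ← hsolid] at hflux
  rw [dphaseProfile_self, dphaseProfile_self, rpow_natCast_div_two ht.le, Real.rpow_natCast, front,
    Real.sqrt_mul hds.le, Real.sqrt_mul hdl.le]
  calc _ = √t ^ n / √t * (D.liquidCoeff n ν *
          (ierfc n 0 * dFn n 0 * Real.exp (-ν ^ 2)) / (2 * √D.dl) * D.kl -
        D.solidCoeff n ν *
          (ierfc n 0 * dFn n 0 * Real.exp (-(ν * D.ω) ^ 2)) / (2 * √D.ds) * D.ks) := by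
        field_simp
        ring
    _ = _ := by
        rw [hflux]
        ring

/-- The coefficients of `liquidTemp` are those that satisfy the convective condition. -/
theorem convective_balance (D : StefanData) (hdl : 0 < D.dl) (hkl : 0 < D.kl) (hh0 : 0 < D.h0)
    (n : ℕ) {ν : ℝ} (hν : 0 < ν) {t : ℝ} (ht : 0 < t) :
    D.kl * (t ^ ((n : ℝ) / 2) * dphaseProfile n (D.liquidCoeff n ν) ν 0 *
        (1 / (2 * √(D.dl * t)))) =
      D.h0 * t ^ (-(1 / 2) : ℝ) *
        (t ^ ((n : ℝ) / 2) * phaseProfile n (D.liquidCoeff n ν) ν 0 -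
          D.Tinf * t ^ ((n : ℝ) / 2)) := by
  have hrt := Real.sqrt_pos.2 ht
  have hrl := Real.sqrt_pos.2 hdl
  have hden := D.liquidDenom_pos hkl hh0 n hν.le
  have hG1 := Gamma_one_pos n
  have hG2 := Gamma_half_pos n
  have hbal : D.kl * (D.liquidCoeff n ν * (En n ν * dFn n 0)) =
      2 * √D.dl * D.h0 * (D.Tinf - D.liquidCoeff n ν * (Fn n ν * ierfc n 0)) := by
    have hexpand : D.liquidDenom n ν = D.kl * Real.Gamma ((n : ℝ) / 2 + 1) * En n ν +
      √D.dl * D.h0 * Real.Gamma ((n : ℝ) / 2 + 1 / 2) * Fn n ν := rfl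
    rw [ierfc_zero_arg, dFn_apply_zero, liquidCoeff]
    generalize D.liquidDenom n ν = L at *
    generalize Real.Gamma ((n : ℝ) / 2 + 1) = G₁ at *
    generalize Real.Gamma ((n : ℝ) / 2 + 1 / 2) = G₂ at *
    field_simp
    linear_combination -D.Tinf * hexpand
  rw [Real.rpow_neg ht.le, ← Real.sqrt_eq_rpow, Real.sqrt_mul hdl.le]
  simp only [phaseProfile, dphaseProfile, dEn_apply_zero, Fn_apply_zero, En_apply_zero]
  calc _ = -(t ^ ((n : ℝ) / 2) * (D.kl * (D.liquidCoeff n ν * (En n ν * dFn n 0))) /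
        (2 * √D.dl * √t)) := by ring
    _ = _ := by
      rw [hbal]
      field_simp
      ring

theorem isStefanSolution (D : StefanData) (hdl : 0 < D.dl) (hds : 0 < D.ds) (hkl : 0 < D.kl)
    (hγ : 0 < D.γ) (hh0 : 0 < D.h0) (n : ℕ) {ν : ℝ} (hν : 0 < ν) (heq : D.NuEquation n ν) :
    IsStefanSolution D (n : ℝ) (D.front ν) (D.liquidTemp n ν) (D.solidTemp n ν) := by
  rw [D.liquidTemp_eq, D.solidTemp_eq hds]
  have hdx (C b d x t : ℝ) := hasDerivAt_similarity_space (hasDerivAt_phaseProfile n C b)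
    (t ^ ((n : ℝ) / 2)) d x t
  refine
    { interface_continuous := ?_
      interface_pos := fun t ht => ?_
      liquid_continuous := ?_
      solid_continuous := ?_
      liquid_heat := fun x t ht _ _ => heatEqAt_similarity hdl n (hasDerivAt_phaseProfile n _ _)
        (hasDerivAt_dphaseProfile n _ _) x ht
      solid_heat := fun x t ht _ => heatEqAt_similarity hds n (hasDerivAt_phaseProfile n _ _)
        (hasDerivAt_dphaseProfile n _ _) x ht
      interface_zero := by simp [front]
      liquid_interface := fun t ht => ?_
      solid_interface := fun t ht => ?_
      stefan := fun t ht => ?_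
      convective := fun t ht => ?_
      initial := fun x hx => ?_ }
  · have : Continuous (D.front ν) := by
      unfold front
      fun_prop
    exact this.continuousOn
  · have := Real.sqrt_pos.2 (mul_pos hdl ht)
    simp only [front]
    positivity
  · exact (continuousOn_similarity hdl _ (continuous_phaseProfile n _ _)).mono fun p hp => hp.1
  · exact (continuousOn_similarity hds _ (continuous_phaseProfile n _ _)).mono fun p hp => hp.1
  · simp only [D.simVar_liquid_front hdl ν ht, phaseProfile_self, mul_zero]
  · simp only [D.simVar_solid_front hdl hds ν ht, phaseProfile_self, mul_zero]
  · refine ⟨_, _, _, (hdx _ _ _ _ _).hasDerivWithinAt, (hdx _ _ _ _ _).hasDerivWithinAt,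
      D.hasDerivAt_front hdl ν ht, ?_⟩
    rw [D.simVar_liquid_front hdl ν ht, D.simVar_solid_front hdl hds ν ht]
    exact D.stefan_balance hdl hds hkl hγ hh0 n hν heq ht
  · refine ⟨_, (hdx _ _ _ _ _).hasDerivWithinAt, ?_⟩
    have h0 : simVar D.dl 0 t = 0 := by simp [simVar]
    simp only [h0]
    exact D.convective_balance hdl hkl hh0 n hν ht
  · have h := tendsto_similarity_initial hds n
      (tendsto_phaseProfile_div_pow n (D.solidCoeff n ν) (ν * D.ω)) hx
    refine h.trans_eq ?_
    congr 1
    have hrs := Real.sqrt_pos.2 hds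
    have hc := ierfc_pos n (ν * D.ω)
    have hfac : (0 : ℝ) < n.factorial := by positivity
    rw [solidCoeff, Real.rpow_natCast, div_pow, mul_pow]
    field_simp

end StefanData

/-! ### Constant latent heat -/

theorem En_zero_apply (z : ℝ) : En 0 z = 1 := by
  have := erfc_add_erfc_neg z
  simp only [En, ierfc]
  linarith

theorem erf_eq_one_sub_erfc (z : ℝ) : erf z = 1 - erfc z := by
  have hint (y : ℝ) : IntegrableOn (fun u : ℝ => Real.exp (-u ^ 2)) (Ioi y) := by
    simpa using (integrable_exp_neg_mul_sq one_pos).integrableOn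
  have h := intervalIntegral.integral_interval_add_Ioi (hint 0) (hint z)
  rw [← erfc_zero, erf, erfc, erfc, ← h]
  ring

theorem Fn_zero_apply (z : ℝ) : Fn 0 z = erf z := by
  have := erfc_add_erfc_neg z
  rw [erf_eq_one_sub_erfc]
  simp only [Fn, ierfc]
  linarith

namespace StefanData

theorem threshold_zero (D : StefanData) (hds : 0 < D.ds) :
    D.threshold 0 = D.ks * D.Ti / (D.Tinf * √(Real.pi * D.ds)) := by
  rw [threshold, rpow_sub_one_div_two hds, Real.sqrt_mul Real.pi_pos.le]
  simp
  field_simp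

theorem liquidTemp_zero (D : StefanData) (hkl : 0 < D.kl) (hh0 : 0 < D.h0) {ν : ℝ} (hν : 0 < ν)
    (x t : ℝ) : D.liquidTemp 0 ν x t = D.classicalLiquidTemp ν x t := by
  have hden := D.liquidDenom_pos hkl hh0 0 hν.le
  rw [liquidTemp_eq, classicalLiquidTemp, Real.sqrt_mul Real.pi_pos.le]
  simp only [phaseProfile, liquidCoeff]
  have h : 1 + √Real.pi * √D.dl * D.h0 / D.kl * erf ν = D.liquidDenom 0 ν / D.kl := by
    simp only [liquidDenom, En_zero_apply, Fn_zero_apply]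
    simp [Real.Gamma_one_half_eq, -one_div]
    field_simp
  rw [h]
  simp [En_zero_apply, Fn_zero_apply, Real.Gamma_one_half_eq, -one_div]
  field_simp

theorem solidTemp_zero (D : StefanData) (hds : 0 < D.ds) (ν x t : ℝ) :
    D.solidTemp 0 ν x t = D.classicalSolidTemp ν x t := by
  have hc : 0 < erfc (ν * D.ω) := ierfc_pos 0 _
  rw [D.solidTemp_eq hds, classicalSolidTemp]
  simp only [phaseProfile, solidCoeff, En_zero_apply, Fn_zero_apply, erf_eq_one_sub_erfc, ierfc]
  simp
  field_simp
  ring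

theorem nuEquation_zero_iff (D : StefanData) (hdl : 0 < D.dl) (hds : 0 < D.ds) (hkl : 0 < D.kl)
    (hγ : 0 < D.γ) (hh0 : 0 < D.h0) {x : ℝ} (hx : 0 < x) :
    D.NuEquation 0 x ↔ D.ClassicalNuEquation x := by
  have hrl := Real.sqrt_pos.2 hdl
  have hrs := Real.sqrt_pos.2 hds
  have hpi : 0 < √Real.pi := by positivity
  have hden := D.liquidDenom_pos hkl hh0 0 hx.le
  have hc : 0 < erfc (x * D.ω) := ierfc_pos 0 _
  have hD : 1 + √(Real.pi * D.dl) * D.h0 * erf x / D.kl = D.liquidDenom 0 x / D.kl := by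
    rw [Real.sqrt_mul Real.pi_pos.le]
    simp only [liquidDenom, En_zero_apply, Fn_zero_apply]
    simp [Real.Gamma_one_half_eq, -one_div]
    field_simp
  rw [D.nuEquation_iff hdl hds hkl hγ hh0 0 hx, ClassicalNuEquation, hD, interfaceFlux,
    Real.sqrt_mul (mul_pos Real.pi_pos hdl).le, Real.sqrt_mul Real.pi_pos.le, ← mul_pow,
    Real.exp_neg, Real.exp_neg]
  have hscale : D.γ * √D.dl ≠ 0 := by positivity
  rw [← mul_right_inj' hscale (b := _ + _)]
  have he1 := Real.exp_pos (x ^ 2)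
  have he2 := Real.exp_pos ((x * D.ω) ^ 2)
  refine Eq.congr ?_ ?_
  · simp only [ierfc, pow_zero, mul_one, one_mul]
    field_simp
    ring
  · ring

end StefanData

theorem mainTheorem3 (D : StefanData) (n : ℕ)
    (hdl : 0 < D.dl) (hds : 0 < D.ds) (hkl : 0 < D.kl) (hks : 0 < D.ks)
    (hγ : 0 < D.γ) (hTinf : 0 < D.Tinf) (hTi : 0 < D.Ti)
    (hh0 : D.threshold n < D.h0) :
    (∃ ν : ℝ, 0 < ν ∧ D.NuEquation n ν ∧
      (∀ x : ℝ, 0 < x → D.NuEquation n x → x = ν) ∧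
      IsStefanSolution D (n : ℝ) (D.front ν) (D.liquidTemp n ν) (D.solidTemp n ν)) ∧
    (n = 0 →
      D.threshold n = D.ks * D.Ti / (D.Tinf * √(Real.pi * D.ds)) ∧
      (∀ x : ℝ, 0 < x → (D.NuEquation n x ↔ D.ClassicalNuEquation x)) ∧
      ∀ ν x t : ℝ, 0 < ν → 0 < t →
        D.liquidTemp n ν x t = D.classicalLiquidTemp ν x t ∧
        D.solidTemp n ν x t = D.classicalSolidTemp ν x t) := by
  have hh : 0 < D.h0 := (D.threshold_pos hds hks hTinf hTi n).trans hh0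
  refine ⟨?_, ?_⟩
  · obtain ⟨ν, hν, heq, huniq⟩ :=
      D.existsUnique_nuEquation hdl hds hkl hks hγ hTinf hTi n hh0
    exact ⟨ν, hν, heq, huniq, D.isStefanSolution hdl hds hkl hγ hh n hν heq⟩
  · rintro rfl
    exact ⟨D.threshold_zero hds, fun x hx => D.nuEquation_zero_iff hdl hds hkl hγ hh hx,
      fun ν x t hν _ => ⟨D.liquidTemp_zero hkl hh hν x t, D.solidTemp_zero hds ν x t⟩⟩
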